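/- Let $\mathbb K\in\{\mathbb R,\mathbb C\}$, let $w$ be the space of all sequences $x=(x_n)_{n\ge 0}$ in $\mathbb K$, let $p=(p_k)_{k\ge0}$ be a bounded sequence of strictly positive real numbers, and let $r,s,t\in w$ with $r_n\ne0$ and $t_n\ne 0$ for all $n$ and $s_0\neq 0$. Put \[ l_\infty(p)=\{x\in w:\sup_k|x_k|^{p_k}<\infty\},\qquad c(p)=\{x\in w:\exists\, l\in\mathbb K,\ \lim_k|x_k-l|^{p_k}=0\}, \] \[ c_0(p)=\{x\in w:\lim_k|x_k|^{p_k}=0\},\qquad l(p)=\Big\{x\in w:\sum_{k}|x_k|^{p_k}<\infty\Big\}. \] With $\Delta x_k=x_k-x_{k-1}$, $x_{-1}=0$, let \[ X(r,s,t,p;\Delta)=\Big\{x\in w:\Big(\tfrac1{r_n}\sum_{k=0}^n s_{n-k}t_k\,\Delta x_k\Big)_{n}\in X\Big\},\qquad X\in\{l_\infty(p),c(p),c_0(p),l(p)\}, \] and denote these spaces by $l_\infty(r,s,t,p;\Delta)$, $c(r,s,t,p;\Delta)$, $c_0(r,s,t,p;\Delta)$ and $l(r,s,t,p;\Delta)$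 respectively. The $\gamma$-dual of $U\subseteq w$ is \[ U^\gamma=\Big\{a\in w:\ \sup_n\Big|\sum_{k=0}^n a_ku_k\Big|<\infty\ \text{ for all } u\in U\Big\}. \] Let $D^{(s)}_0=1/s_0$ and, for $n\ge1$, $D_n^{(s)}=s_0^{-(n+1)}\det(d_{ij})_{1\le i,j\le n}$, where $d_{ij}=s_{i-j+1}$ for $j\le i+1$ and $d_{ij}=0$ for $j>i+1$. For $a\in w$ let $E=(e_{nk})_{n,k\ge 0}$ be the matrix with $e_{nk}=0$ for $k>n$ and \[ e_{nk}=r_k\Big[\frac{a_k}{s_0t_k}+\Big(\frac{D_0^{(s)}}{t_k}-\frac{D_1^{(s)}}{t_{k+1}}\Big)\sum_{j=k+1}^n a_j+\sum_{l=k+2}^n(-1)^{l-k}\frac{D_{l-k}^{(s)}}{t_l}\sum_{j=l}^n a_j\Big]\qquad(0\le k\le n), \] empty sums being $0$. With $\mathbb N=\{1,2,\dots\}$, and with $p_k'=p_k/(p_k-1)$ in the definition of $\Gamma_5(p)$, which is used only when all $p_k>1$, put \[ \Gamma_1(p)=\bigcup_{L\in\mathbb N}\Big\{a\in w:\sup_n\sum_{k}|e_{nk}|L^{-1/p_k}<\infty\Big\},\qquad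 \Gamma_2(p)=\Big\{a\in w:\sup_n\Big|\sum_k e_{nk}\Big|<\infty\Big\}, \] \[ \Gamma_3(p)=\bigcap_{L\in\mathbb N}\Big\{a\in w:\sup_n\sum_{k}|e_{nk}|L^{1/p_k}<\infty\Big\},\qquad \Gamma_4(p)=\bigcup_{L\in\mathbb N}\Big\{a\in w:\sup_n\sup_k|e_{nk}L^{-1}|^{p_k}<\infty\Big\}, \] \[ \Gamma_5(p)=\bigcup_{L\in\mathbb N}\Big\{a\in w:\sup_n\sum_k|e_{nk}L^{-1}|^{p_k'}<\infty\Big\}. \] Then: (a) if $p_k>1$ for all $k$, then $[l(r,s,t,p;\Delta)]^\gamma=\Gamma_5(p)$; if $0<p_k\le1$ for all $k$, then $[l(r,s,t,p;\Delta)]^\gamma=\Gamma_4(p)$; (b) in general (that is, $0<p_k\le \sup_j p_j<\infty$ for all $k$), $[c_0(r,s,t,p;\Delta)]^\gamma=\Gamma_1(p)$, $[c(r,s,t,p;\Delta)]^\gamma=\Gamma_1(p)\cap\Gamma_2(p)$ and $[l_\infty(r,s,t,p;\Delta)]^\gamma=\Gamma_3(p)$. -/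

import Mathlib

namespace GenMeans

noncomputable section

open Filter Topology

variable {𝕜 : Type*} [RCLike 𝕜]

/-- Maddox's space `l_∞(p)`. -/
def maddoxLinf (p : ℕ → ℝ) : Set (ℕ → 𝕜) :=
  {x | BddAbove (Set.range fun k => ‖x k‖ ^ p k)}

/-- Maddox's space `c(p)`. -/
def maddoxC (p : ℕ → ℝ) : Set (ℕ → 𝕜) :=
  {x | ∃ l : 𝕜, Tendsto (fun k => ‖x k - l‖ ^ p k) atTop (𝓝 0)}

/-- Maddox's space `c_0(p)`. -/
def maddoxC0 (p : ℕ → ℝ) : Set (ℕ → 𝕜) :=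
  {x | Tendsto (fun k => ‖x k‖ ^ p k) atTop (𝓝 0)}

/-- Maddox's space `l(p)`. -/
def maddoxL (p : ℕ → ℝ) : Set (ℕ → 𝕜) :=
  {x | Summable fun k => ‖x k‖ ^ p k}

/-- The space `bs` of sequences whose series has bounded partial sums. -/
def bs : Set (ℕ → 𝕜) :=
  {x | BddAbove (Set.range fun n => ‖∑ k ∈ Finset.range (n + 1), x k‖)}

/-- The multiplier space `M(U, V)`. -/
def multiplierSpace (U V : Set (ℕ → 𝕜)) : Set (ℕ → 𝕜) :=
  {a | ∀ u ∈ U, (fun n => a n * u n) ∈ V}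

/-- The `γ`-dual `M(U, bs)` of `U`. -/
def gammaDual (U : Set (ℕ → 𝕜)) : Set (ℕ → 𝕜) :=
  multiplierSpace U bs

/-- The difference operator `Δ x_k = x_k - x_{k-1}`, with `x_{-1} = 0`. -/
def diff (x : ℕ → 𝕜) : ℕ → 𝕜
  | 0 => x 0
  | k + 1 => x (k + 1) - x k

/-- The sequence of generalized means `(1 / r_n) ∑_{k ≤ n} s_{n-k} t_k x_k` of `x`. -/
def genMean (r s t x : ℕ → 𝕜) (n : ℕ) : 𝕜 :=
  (1 / r n) * ∑ k ∈ Finset.range (n + 1), s (n - k) * t k * x k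

/-- The space `X(r, s, t; Δ)` of all `x` for which the generalized means of `Δ x` lie in `X`. -/
def meanDiffSpace (X : Set (ℕ → 𝕜)) (r s t : ℕ → 𝕜) : Set (ℕ → 𝕜) :=
  {x | genMean r s t (diff x) ∈ X}

/-- The number `D_n^{(s)}`: `s_0^{-(n+1)}` times the `n × n` determinant with entry `s_{i-j+1}` in
row `i` and column `j` (zero when `j > i + 1`). For `n = 0` the empty determinant is `1`, so that
`D_0^{(s)} = 1 / s_0`. -/
def D (s : ℕ → 𝕜) (n : ℕ) : 𝕜 :=
  (1 / s 0 ^ (n + 1)) *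
    (Matrix.of fun i j : Fin n =>
      if (j : ℕ) ≤ (i : ℕ) + 1 then s ((i : ℕ) + 1 - (j : ℕ)) else 0).det

/-- The entry `e_{nk}` of the triangular matrix `E` attached to the sequence `a`. -/
def E (r s t a : ℕ → 𝕜) (n k : ℕ) : 𝕜 :=
  if k ≤ n then
    r k * (a k / (s 0 * t k)
      + (D s 0 / t k - D s 1 / t (k + 1)) * ∑ j ∈ Finset.Icc (k + 1) n, a j
      + ∑ l ∈ Finset.Icc (k + 2) n,
          (-1) ^ (l - k) * (D s (l - k) / t l) * ∑ j ∈ Finset.Icc l n, a j)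
  else 0

/-- `Γ₁(p)`; the index `L` runs over the positive integers, sums and suprema of nonnegative
quantities are taken in `[0, ∞]`. -/
def Gamma1 (r s t : ℕ → 𝕜) (p : ℕ → ℝ) : Set (ℕ → 𝕜) :=
  ⋃ L : ℕ+, {a | (⨆ n, ∑' k, ENNReal.ofReal (‖E r s t a n k‖ * (L : ℝ) ^ (-1 / p k))) < ⊤}

/-- `Γ₂(p)`; each row of `E` has only finitely many nonzero entries, so the series is a finite
sum. -/
def Gamma2 (r s t : ℕ → 𝕜) : Set (ℕ → 𝕜) :=
  {a | BddAbove (Set.range fun n => ‖∑' k, E r s t a n k‖)}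

/-- `Γ₃(p)`. -/
def Gamma3 (r s t : ℕ → 𝕜) (p : ℕ → ℝ) : Set (ℕ → 𝕜) :=
  ⋂ L : ℕ+, {a | (⨆ n, ∑' k, ENNReal.ofReal (‖E r s t a n k‖ * (L : ℝ) ^ (1 / p k))) < ⊤}

/-- `Γ₄(p)`. -/
def Gamma4 (r s t : ℕ → 𝕜) (p : ℕ → ℝ) : Set (ℕ → 𝕜) :=
  ⋃ L : ℕ+, {a | (⨆ n, ⨆ k, ENNReal.ofReal (‖E r s t a n k * (L : 𝕜)⁻¹‖ ^ p k)) < ⊤}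

/-- `Γ₅(p)`, with the conjugate exponents `p_k' = p_k / (p_k - 1)`. -/
def Gamma5 (r s t : ℕ → 𝕜) (p : ℕ → ℝ) : Set (ℕ → 𝕜) :=
  ⋃ L : ℕ+, {a | (⨆ n, ∑' k,
    ENNReal.ofReal (‖E r s t a n k * (L : 𝕜)⁻¹‖ ^ (p k / (p k - 1)))) < ⊤}

end

end GenMeans

namespace GenMeans

open Filter Topology

variable {𝕜 : Type*} [RCLike 𝕜]

/-! Multiplication by `t`, convolution with `s` and division by `r` are invertible on the space of
all sequences, and so is `diff`; hence `x ↦ y = genMean r s t (diff x)` is a bijection. Cramer's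
rule for the triangular Toeplitz system of `s` identifies the coefficients of the inverse
convolution as `(-1) ^ n * D s n` (`coeff_inv_mk`). Summation by parts then rewrites the partial
sums of `∑ a_k x_k` as the rows of `E` applied to `y` (`sum_mul_eq_sum_E`). So `a` lies in the
γ-dual exactly when the triangular matrix `E` maps the Maddox space into the bounded sequences
(`mem_gammaDual_iff`), and everything reduces to characterizing such matrices.

Sufficiency of each row condition is a termwise estimate (Young's inequality when all `p k > 1`).
Necessity is a gliding hump (`exists_gliding_hump`): unit vectors show that the columns are bounded,
so failure of the row condition must come from arbitrarily far tails of rows; blocks nearly extremal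
for those tails are glued to an element of the space with unbounded transform. The space `c(p)` is
`c_0(p)` plus the constants. -/

/-! ### The determinants `D` and the inverse power series -/

/-- Up to sign, the numbers `D s n` are the coefficients of the inverse of `∑ s_n X ^ n`. -/
theorem coeff_inv_mk (s : ℕ → 𝕜) (hs : s 0 ≠ 0) (n : ℕ) :
    PowerSeries.coeff n (PowerSeries.mk s)⁻¹ = (-1) ^ n * D s n := by
  set u : ℕ → 𝕜 := fun n => PowerSeries.coeff n (PowerSeries.mk s)⁻¹ with hu
  have hinv : PowerSeries.mk s * (PowerSeries.mk s)⁻¹ = 1 :=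
    PowerSeries.mul_inv_cancel _ (by simpa using hs)
  have hconv : ∀ m, ∑ k ∈ Finset.range (m + 1), s (m - k) * u k = if m = 0 then 1 else 0 := by
    intro m
    have h := congrArg (PowerSeries.coeff m) hinv
    rw [PowerSeries.coeff_mul, PowerSeries.coeff_one,
      Finset.Nat.sum_antidiagonal_eq_sum_range_succ_mk] at h
    rw [← h, ← Finset.sum_range_reflect]
    refine Finset.sum_congr rfl fun k hk => ?_
    have hk' : k ≤ m := by simpa [Nat.lt_succ_iff] using hk
    have h2 : m - (m - k) = k := by omega
    simp [h2, hu]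
  -- Truncating the convolution identity gives a lower triangular Toeplitz system `T u = e₀` with
  -- determinant `s 0 ^ (n + 1)`.
  set T : Matrix (Fin (n + 1)) (Fin (n + 1)) 𝕜 :=
    Matrix.of fun i j => if (j : ℕ) ≤ i then s ((i : ℕ) - j) else 0 with hT
  have hdet : T.det = s 0 ^ (n + 1) := by
    rw [Matrix.det_of_isLowerTriangular]
    · simp [hT]
    · intro i j hij
      have hij' : i < j := by simpa using hij
      simp [hT, hij'.not_ge]
  have hTu : T.mulVec (fun i => u i) = Pi.single 0 1 := by
    ext i
    have h := hconv i
    have hle : (i : ℕ) + 1 ≤ n + 1 := i.2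
    change ∑ k : Fin (n + 1), (if (k : ℕ) ≤ (i : ℕ) then s ((i : ℕ) - k) else 0) * u k = _
    rw [Fin.sum_univ_eq_sum_range
      (fun k => (if k ≤ (i : ℕ) then s ((i : ℕ) - k) else 0) * u k) (n + 1),
      ← Finset.sum_subset (Finset.range_mono hle)]
    · rw [Finset.sum_congr rfl (g := fun k => s ((i : ℕ) - k) * u k), h]
      · by_cases hi : i = 0
        · simp [hi]
        · simp [hi]
      · intro k hk
        have : k ≤ (i : ℕ) := by simpa [Nat.lt_succ_iff] using hk
        simp [this]
    · intro k _ hk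
      have : ¬ k ≤ (i : ℕ) := by simpa [Nat.lt_succ_iff] using hk
      simp [this]
  -- Cramer's rule: the last unknown `u n` is the cofactor in the corner (last, 0) of the adjugate,
  -- divided by `det T`.
  have hadj : T.adjugate.mulVec (T.mulVec fun i => u i) = T.det • fun i : Fin (n + 1) => u i := by
    rw [Matrix.mulVec_mulVec, Matrix.adjugate_mul, Matrix.smul_mulVec, Matrix.one_mulVec]
  rw [hTu] at hadj
  have hlast := congrFun hadj (Fin.last n)
  rw [Matrix.mulVec_single_one, Matrix.col_apply,
    Matrix.adjugate_fin_succ_eq_det_submatrix, hdet] at hlast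
  -- Deleting the first row and the last column shifts the row index by one, which produces the
  -- Hessenberg matrix in `D`.
  have hsub : T.submatrix (Fin.succAbove 0) (Fin.succAbove (Fin.last n)) =
      Matrix.of fun i j : Fin n =>
        if (j : ℕ) ≤ (i : ℕ) + 1 then s ((i : ℕ) + 1 - (j : ℕ)) else 0 := by
    ext i j
    simp only [hT, Matrix.submatrix_apply, Matrix.of_apply, Fin.succAbove_last,
      Fin.succAbove_zero, Fin.val_succ, Fin.val_castSucc]
  rw [hsub] at hlast
  simp only [Fin.val_zero, Fin.val_last, zero_add, Pi.smul_apply, smul_eq_mul] at hlast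
  have hs' : s 0 ^ (n + 1) ≠ 0 := pow_ne_zero _ hs
  change u n = _
  rw [D, ← mul_assoc, mul_comm _ (1 / _), mul_assoc, hlast]
  field_simp

/-- In generating functions the left side says `(t d) * s = r y`; multiplying by the inverse series
of `s` solves for `t d`. -/
theorem genMean_eq_iff (r s t d y : ℕ → 𝕜) (hr : ∀ n, r n ≠ 0) (hs : s 0 ≠ 0) :
    genMean r s t d = y ↔
      ∀ l, t l * d l =
        ∑ k ∈ Finset.range (l + 1), (-1) ^ (l - k) * D s (l - k) * (r k * y k) := by
  have hinv : PowerSeries.mk s * (PowerSeries.mk s)⁻¹ = 1 :=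
    PowerSeries.mul_inv_cancel _ (by simpa using hs)
  have h1 : genMean r s t d = y ↔
      (PowerSeries.mk fun k => t k * d k) * PowerSeries.mk s = PowerSeries.mk fun k => r k * y k := by
    rw [PowerSeries.ext_iff, funext_iff]
    refine forall_congr' fun n => ?_
    rw [PowerSeries.coeff_mul, Finset.Nat.sum_antidiagonal_eq_sum_range_succ_mk]
    simp only [PowerSeries.coeff_mk, genMean]
    rw [one_div, inv_mul_eq_iff_eq_mul₀ (hr n)]
    refine Eq.congr_left (Finset.sum_congr rfl fun k _ => by ring)
  have h2 : (∀ l, t l * d l =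
        ∑ k ∈ Finset.range (l + 1), (-1) ^ (l - k) * D s (l - k) * (r k * y k)) ↔
      (PowerSeries.mk fun k => t k * d k) =
        (PowerSeries.mk fun k => r k * y k) * (PowerSeries.mk s)⁻¹ := by
    rw [PowerSeries.ext_iff]
    refine forall_congr' fun n => ?_
    rw [PowerSeries.coeff_mul, Finset.Nat.sum_antidiagonal_eq_sum_range_succ_mk]
    simp only [PowerSeries.coeff_mk, coeff_inv_mk s hs]
    refine Eq.congr_right (Finset.sum_congr rfl fun k _ => by ring)
  rw [h1, h2]
  constructor
  · intro h
    rw [← h, mul_assoc, hinv, mul_one]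
  · intro h
    rw [h, mul_assoc, mul_comm _ (PowerSeries.mk s), hinv, mul_one]

/-! ### Differences, the matrix `E`, and reduction of the γ-dual to a matrix map -/

theorem sum_range_diff (x : ℕ → 𝕜) (n : ℕ) : ∑ l ∈ Finset.range (n + 1), diff x l = x n := by
  induction n with
  | zero => simp [diff]
  | succ n ih => rw [Finset.sum_range_succ, ih]; simp [diff]

theorem exists_diff_eq (d : ℕ → 𝕜) : ∃ x, diff x = d := by
  refine ⟨fun n => ∑ l ∈ Finset.range (n + 1), d l, ?_⟩
  ext n
  cases n with
  | zero => simp [diff]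
  | succ n => simp [diff, Finset.sum_range_succ _ (n + 1)]

/-- The definition of `E` merely splits off the terms `l = k` and `l = k + 1`; the uniform sum is
the form that an interchange of summation yields. -/
theorem E_eq_sum (r s t a : ℕ → 𝕜) {n k : ℕ} (h : k ≤ n) :
    E r s t a n k = r k * ∑ l ∈ Finset.Icc k n,
      (-1) ^ (l - k) * (D s (l - k) / t l) * ∑ j ∈ Finset.Icc l n, a j := by
  have hD : D s 0 = 1 / s 0 := by simp [D]
  rw [E, if_pos h]
  congr 1
  have e1 : Finset.Icc k n = insert k (Finset.Icc (k + 1) n) := by ext; simp; omega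
  have e0 : k ∉ Finset.Icc (k + 1) n := by simp
  rw [e1, Finset.sum_insert e0]
  have e4 : ∑ j ∈ Finset.Icc k n, a j = a k + ∑ j ∈ Finset.Icc (k + 1) n, a j := by
    rw [e1, Finset.sum_insert e0]
  rw [e4]
  rcases h.eq_or_lt with rfl | hlt
  · simp [hD, div_eq_mul_inv, mul_comm, mul_assoc, mul_left_comm]
  · have e2 : Finset.Icc (k + 1) n = insert (k + 1) (Finset.Icc (k + 2) n) := by ext; simp; omega
    have e3 : ∑ l ∈ Finset.Icc (k + 1) n,
        (-1) ^ (l - k) * (D s (l - k) / t l) * ∑ j ∈ Finset.Icc l n, a j =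
        - (D s 1 / t (k + 1)) * (∑ j ∈ Finset.Icc (k + 1) n, a j) +
        ∑ l ∈ Finset.Icc (k + 2) n,
          (-1) ^ (l - k) * (D s (l - k) / t l) * ∑ j ∈ Finset.Icc l n, a j := by
      conv_lhs => rw [e2, Finset.sum_insert (by simp)]
      simp
    rw [e3, Nat.sub_self, hD]
    simp only [pow_zero, one_mul, div_eq_mul_inv, mul_inv]
    ring

theorem E_eq_zero (r s t a : ℕ → 𝕜) {n k : ℕ} (h : n < k) : E r s t a n k = 0 := by
  rw [E, if_neg (by omega)]

/-- Summation by parts: the partial sums of `∑ a_k x_k` in terms of the means of `Δ x`. -/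
theorem sum_mul_eq_sum_E (r s t a x : ℕ → 𝕜) (hr : ∀ n, r n ≠ 0) (ht : ∀ n, t n ≠ 0)
    (hs : s 0 ≠ 0) (n : ℕ) :
    ∑ m ∈ Finset.range (n + 1), a m * x m =
      ∑ k ∈ Finset.range (n + 1), E r s t a n k * genMean r s t (diff x) k := by
  have hd := (genMean_eq_iff r s t (diff x) _ hr hs).1 rfl
  set y := genMean r s t (diff x)
  have hd' : ∀ l, diff x l = ∑ k ∈ Finset.range (l + 1),
      (-1) ^ (l - k) * (D s (l - k) / t l) * (r k * y k) := by
    intro l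
    rw [← mul_right_inj' (ht l), hd l, Finset.mul_sum]
    refine Finset.sum_congr rfl fun k _ => ?_
    have := ht l
    field_simp
  calc ∑ m ∈ Finset.range (n + 1), a m * x m
      = ∑ m ∈ Finset.range (n + 1), ∑ l ∈ Finset.range (m + 1), a m * diff x l := by
        refine Finset.sum_congr rfl fun m _ => ?_
        rw [← Finset.mul_sum, sum_range_diff]
    _ = ∑ l ∈ Finset.range (n + 1), ∑ m ∈ Finset.Icc l n, a m * diff x l := by
        refine Finset.sum_comm' fun m l => ?_
        simp only [Finset.mem_range, Finset.mem_Icc]; omega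
    _ = ∑ l ∈ Finset.range (n + 1), ∑ k ∈ Finset.range (l + 1),
          (-1) ^ (l - k) * (D s (l - k) / t l) * (r k * y k) * ∑ j ∈ Finset.Icc l n, a j := by
        refine Finset.sum_congr rfl fun l _ => ?_
        rw [← Finset.sum_mul, ← Finset.sum_mul, ← hd' l, mul_comm]
    _ = ∑ k ∈ Finset.range (n + 1), ∑ l ∈ Finset.Icc k n,
          (-1) ^ (l - k) * (D s (l - k) / t l) * (r k * y k) * ∑ j ∈ Finset.Icc l n, a j := by
        refine Finset.sum_comm' fun m l => ?_
        simp only [Finset.mem_range, Finset.mem_Icc]; omega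
    _ = _ := by
        refine Finset.sum_congr rfl fun k hk => ?_
        rw [E_eq_sum r s t a (by simpa [Nat.lt_succ_iff] using hk), Finset.mul_sum, Finset.sum_mul]
        refine Finset.sum_congr rfl fun l _ => ?_
        ring

/-- The matrix `A`, with rows cut off at the diagonal, maps `X` into the bounded sequences. -/
def MapsToBounded (A : ℕ → ℕ → 𝕜) (X : Set (ℕ → 𝕜)) : Prop :=
  ∀ y ∈ X, BddAbove (Set.range fun n => ‖∑ k ∈ Finset.range (n + 1), A n k * y k‖)

/-- Summation by parts turns one boundedness statement into the other; the forward direction also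
needs every `y ∈ X` to be the mean sequence of some `Δ x`. -/
theorem mem_gammaDual_iff (X : Set (ℕ → 𝕜)) (r s t a : ℕ → 𝕜) (hr : ∀ n, r n ≠ 0)
    (ht : ∀ n, t n ≠ 0) (hs : s 0 ≠ 0) :
    a ∈ gammaDual (meanDiffSpace X r s t) ↔ MapsToBounded (E r s t a) X := by
  constructor
  · intro h y hy
    obtain ⟨x, hx⟩ := exists_diff_eq (fun l => (t l)⁻¹ *
      ∑ k ∈ Finset.range (l + 1), (-1) ^ (l - k) * D s (l - k) * (r k * y k))
    have hxy : genMean r s t (diff x) = y := by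
      rw [genMean_eq_iff r s t _ _ hr hs]
      intro l
      rw [hx, mul_inv_cancel_left₀ (ht l)]
    have hb := h x (by simpa [meanDiffSpace, hxy] using hy)
    simp only [bs, Set.mem_ofPred_eq, sum_mul_eq_sum_E r s t a x hr ht hs, hxy] at hb
    exact hb
  · intro h x hx
    have hb := h _ hx
    simp only [bs, Set.mem_ofPred_eq, sum_mul_eq_sum_E r s t a x hr ht hs]
    exact hb

/-! ### Triangular matrices into the bounded sequences -/

theorem maddoxC0_single (p : ℕ → ℝ) (hp : ∀ k, 0 < p k) (i : ℕ) :
    (Pi.single i 1 : ℕ → 𝕜) ∈ maddoxC0 p := by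
  refine tendsto_const_nhds.congr' ?_
  filter_upwards [eventually_gt_atTop i] with k hk
  simp [hk.ne', Real.zero_rpow (hp k).ne']

theorem maddoxL_single (p : ℕ → ℝ) (hp : ∀ k, 0 < p k) (i : ℕ) :
    (Pi.single i 1 : ℕ → 𝕜) ∈ maddoxL p := by
  refine summable_of_ne_finset_zero (s := {i}) fun k hk => ?_
  have hk' : k ≠ i := by simpa using hk
  simp [hk', Real.zero_rpow (hp k).ne']

theorem MapsToBounded.mono {A : ℕ → ℕ → 𝕜} {X Y : Set (ℕ → 𝕜)} (h : MapsToBounded A Y)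
    (hXY : X ⊆ Y) : MapsToBounded A X := fun y hy => h y (hXY hy)

/-- Testing on the unit vector at `k` bounds column `k`. This makes the first columns harmless in
the gliding hump. -/
theorem MapsToBounded.exists_column_bound {A : ℕ → ℕ → 𝕜} {X : Set (ℕ → 𝕜)}
    (h : MapsToBounded A X) (hA : ∀ n k, n < k → A n k = 0)
    (hX : ∀ i, (Pi.single i 1 : ℕ → 𝕜) ∈ X) :
    ∃ C : ℕ → ℝ, ∀ n k, ‖A n k‖ ≤ C k := by
  have h1 : ∀ k, ∃ C : ℝ, ∀ n, ‖A n k‖ ≤ C := by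
    intro k
    obtain ⟨C, hC⟩ := h _ (hX k)
    refine ⟨C, fun n => ?_⟩
    have := hC ⟨n, rfl⟩
    simp only [Pi.single_apply, mul_ite, mul_one, mul_zero, Finset.sum_ite_eq'] at this
    split_ifs at this with hk
    · exact this
    · rw [hA n k (by simpa using hk)]
      exact this
  choose C hC using h1
  exact ⟨C, fun n k => hC k n⟩

/-! ### Blocks of indices and the gliding hump -/

theorem sum_range_succ_eq_add_sum_Ioc {M : Type*} [AddCommMonoid M] (f : ℕ → M) {m n : ℕ}
    (h : m ≤ n) : ∑ k ∈ Finset.range (n + 1), f k =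
      ∑ k ∈ Finset.range (m + 1), f k + ∑ k ∈ Finset.Ioc m n, f k := by
  have e : Finset.Ioc m n = Finset.Ico (m + 1) (n + 1) := by ext; simp
  rw [e, Finset.sum_range_add_sum_Ico _ (by omega)]

theorem exists_mem_Ioc_of_strictMono {N : ℕ → ℕ} (hN : StrictMono N) (hN0 : N 0 = 0) {k : ℕ}
    (hk : 0 < k) : ∃ j, k ∈ Finset.Ioc (N j) (N (j + 1)) := by
  have hex : ∃ j, k ≤ N j := ⟨k, hN.id_le k⟩
  obtain ⟨j, hj⟩ := Nat.exists_eq_succ_of_ne_zero (n := Nat.find hex) fun h0 => by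
    have := Nat.find_spec hex
    rw [h0, hN0] at this
    omega
  refine ⟨j, Finset.mem_Ioc.2 ⟨not_le.1 (Nat.find_min hex (by omega)), ?_⟩⟩
  have := Nat.find_spec hex
  rwa [hj] at this

/-- Gliding hump: if a matrix with bounded columns admits, beyond every index `m`, arbitrarily large
values on blocks `v` with the property `P`, then such blocks can be glued to a sequence `y` whose
transform is unbounded. -/
theorem exists_gliding_hump {A : ℕ → ℕ → 𝕜} {C : ℕ → ℝ} (hC : ∀ n k, ‖A n k‖ ≤ C k)
    (P : ℕ → ℕ → ℕ → (ℕ → 𝕜) → Prop)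
    (h : ∀ (j m : ℕ) (M : ℝ), 0 ≤ M → ∃ n v, (∀ k ∈ Finset.Ioc m n, ‖v k‖ ≤ 1) ∧ P j m n v ∧
      M < ‖∑ k ∈ Finset.Ioc m n, A n k * v k‖) :
    ∃ (N : ℕ → ℕ) (y : ℕ → 𝕜), StrictMono N ∧ N 0 = 0 ∧ (∀ k, ‖y k‖ ≤ 1) ∧ y 0 = 0 ∧
      (∀ j, ∃ v, P j (N j) (N (j + 1)) v ∧ ∀ k ∈ Finset.Ioc (N j) (N (j + 1)), y k = v k) ∧
      ¬ BddAbove (Set.range fun n => ‖∑ k ∈ Finset.range (n + 1), A n k * y k‖) := by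
  have hC0 : ∀ k, 0 ≤ C k := fun k => (norm_nonneg _).trans (hC 0 k)
  set B : ℕ → ℝ := fun m => ∑ k ∈ Finset.range (m + 1), C k with hB
  have hB0 : ∀ m, 0 ≤ B m := fun m => Finset.sum_nonneg fun k _ => hC0 k
  -- `B m` dominates what the columns up to `m` can contribute against a sequence bounded by 1, so a
  -- block sum above `B m + j` leaves a total above `j`.
  have h' : ∀ j m : ℕ, ∃ n v, (∀ k ∈ Finset.Ioc m n, ‖v k‖ ≤ 1) ∧ P j m n v ∧
      B m + j < ‖∑ k ∈ Finset.Ioc m n, A n k * v k‖ :=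
    fun j m => h j m _ (add_nonneg (hB0 m) j.cast_nonneg)
  choose nn vv hv1 hvP hvM using h'
  have hnn : ∀ j m, m < nn j m := by
    intro j m
    by_contra hle
    have := hvM j m
    rw [Finset.Ioc_eq_empty_of_le (not_lt.1 hle), Finset.sum_empty, norm_zero] at this
    have := hB0 m
    have : (0 : ℝ) ≤ j := j.cast_nonneg
    linarith
  let N : ℕ → ℕ := fun j => Nat.rec 0 (fun j m => nn j m) j
  have hNs : ∀ j, N (j + 1) = nn j (N j) := fun j => rfl
  have hN : StrictMono N := strictMono_nat_of_lt_succ fun j => by rw [hNs]; exact hnn _ _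
  have hex : ∀ k, ∃ j, k ≤ N (j + 1) := fun k => ⟨k, (Nat.le_succ k).trans (hN.id_le _)⟩
  classical
  -- The blocks `Ioc (N j) (N (j + 1))` cover all positive indices but not 0, where `y` is set to 0.
  let y : ℕ → 𝕜 := fun k => if k = 0 then 0 else vv (Nat.find (hex k)) (N (Nat.find (hex k))) k
  have hy : ∀ j, ∀ k ∈ Finset.Ioc (N j) (N (j + 1)), y k = vv j (N j) k := by
    intro j k hk
    rw [Finset.mem_Ioc] at hk
    have hfind : Nat.find (hex k) = j := by
      rw [Nat.find_eq_iff]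
      refine ⟨hk.2, fun i hi => ?_⟩
      have : N (i + 1) ≤ N j := hN.monotone hi
      omega
    have hk0 : k ≠ 0 := by omega
    simp only [y, if_neg hk0, hfind]
  have hy1 : ∀ k, ‖y k‖ ≤ 1 := by
    intro k
    rcases Nat.eq_zero_or_pos k with rfl | hk
    · simp [y]
    · obtain ⟨j, hj⟩ := exists_mem_Ioc_of_strictMono hN rfl hk
      rw [hy j k hj]
      exact hv1 _ _ k hj
  refine ⟨N, y, hN, rfl, hy1, by simp [y], fun j => ⟨vv j (N j), hvP j (N j), hy j⟩, ?_⟩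
  rintro ⟨K, hK⟩
  obtain ⟨j, hj⟩ := exists_nat_gt K
  have h1 := hK ⟨N (j + 1), rfl⟩
  have hle : N j ≤ N (j + 1) := (hN (Nat.lt_succ_self j)).le
  simp only [sum_range_succ_eq_add_sum_Ioc _ hle] at h1
  have h2 : ‖∑ k ∈ Finset.range (N j + 1), A (N (j + 1)) k * y k‖ ≤ B (N j) := by
    refine norm_sum_le_of_le _ fun k _ => ?_
    rw [norm_mul]
    calc _ ≤ C k * 1 := mul_le_mul (hC _ _) (hy1 k) (norm_nonneg _) (hC0 k)
      _ = C k := mul_one _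
  have h3 := hvM j (N j)
  have hblock : ∑ k ∈ Finset.Ioc (N j) (N (j + 1)), A (N (j + 1)) k * y k =
      ∑ k ∈ Finset.Ioc (N j) (N (j + 1)), A (N (j + 1)) k * vv j (N j) k :=
    Finset.sum_congr rfl fun k hk => by rw [hy j k hk]
  rw [← hNs, ← hblock] at h3
  have h4 := norm_sub_le_norm_add (∑ k ∈ Finset.Ioc (N j) (N (j + 1)), A (N (j + 1)) k * y k)
    (∑ k ∈ Finset.range (N j + 1), A (N (j + 1)) k * y k)
  rw [add_comm] at h1
  linarith

/-- A tail of a row whose weighted absolute sums are unbounded is large. -/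
theorem exists_lt_sum_Ioc {f : ℕ → ℕ → ℝ} {C : ℕ → ℝ} (hf : ∀ n k, 0 ≤ f n k)
    (hC : ∀ n k, f n k ≤ C k)
    (h : ¬ BddAbove (Set.range fun n => ∑ k ∈ Finset.range (n + 1), f n k)) (m : ℕ) (M : ℝ) :
    ∃ n, M < ∑ k ∈ Finset.Ioc m n, f n k := by
  by_contra! hcon
  -- The columns up to `m` cost at most `∑ C k`, the tail at most `M`; the maximum with 0 serves
  -- rows `n ≤ m`, which have no tail.
  refine h ⟨∑ k ∈ Finset.range (m + 1), C k + max M 0, ?_⟩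
  rintro _ ⟨n, rfl⟩
  have hC0 : ∀ k, 0 ≤ C k := fun k => (hf 0 k).trans (hC 0 k)
  rcases le_total m n with hmn | hmn
  · simp only [sum_range_succ_eq_add_sum_Ioc _ hmn]
    exact add_le_add (Finset.sum_le_sum fun k _ => hC n k) ((hcon n).trans (le_max_left _ _))
  · calc ∑ k ∈ Finset.range (n + 1), f n k ≤ ∑ k ∈ Finset.range (n + 1), C k :=
          Finset.sum_le_sum fun k _ => hC n k
      _ ≤ ∑ k ∈ Finset.range (m + 1), C k :=
          Finset.sum_le_sum_of_subset_of_nonneg (Finset.range_mono (by omega)) fun k _ _ => hC0 k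
      _ ≤ _ := le_add_of_nonneg_right (le_max_right _ _)

/-! ### Matrices on `c_0(p)`, `c(p)` and `l_∞(p)` -/

theorem mapsToBounded_maddoxC0_iff {A : ℕ → ℕ → 𝕜} (hA : ∀ n k, n < k → A n k = 0)
    {p : ℕ → ℝ} (hp : ∀ k, 0 < p k) :
    MapsToBounded A (maddoxC0 p) ↔ ∃ L : ℕ+, BddAbove (Set.range fun n =>
      ∑ k ∈ Finset.range (n + 1), ‖A n k‖ * (L : ℝ) ^ (-1 / p k)) := by
  constructor
  · intro h
    obtain ⟨C, hC⟩ := h.exists_column_bound hA (maddoxC0_single p hp)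
    by_contra! hcon
    have hle1 : ∀ (L : ℕ+) k, (L : ℝ) ^ (-1 / p k) ≤ 1 := fun L k =>
      Real.rpow_le_one_of_one_le_of_nonpos (by exact_mod_cast L.pos)
        (div_nonpos_of_nonpos_of_nonneg (by norm_num) (hp k).le)
    choose u hu1 hu using fun n k => RCLike.exists_norm_eq_mul_self (A n k)
    -- Block `j` uses the failure for `L = j + 1`: its entries have modulus `L ^ (-1 / p k)` and
    -- phases aligned with the row. Their `p k`-th powers equal `1 / (j + 1)`, which forces `y` into
    -- `c_0(p)`.
    obtain ⟨N, y, hN, hN0, -, hy0, hyP, hyB⟩ := exists_gliding_hump hC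
      (fun j _ _ v => ∀ k, ‖v k‖ ^ p k ≤ 1 / ((j : ℝ) + 1)) (by
        intro j m M hM
        obtain ⟨n, hn⟩ := exists_lt_sum_Ioc (fun n k => by positivity)
          (fun n k => (mul_le_of_le_one_right (norm_nonneg _) (hle1 _ k)).trans (hC n k))
          (hcon j.succPNat) m M
        have hnorm : ∀ k, ‖u n k * (((j.succPNat : ℝ) ^ (-1 / p k) : ℝ) : 𝕜)‖ =
            (j.succPNat : ℝ) ^ (-1 / p k) := fun k => by
          rw [norm_mul, hu1, one_mul, RCLike.norm_ofReal, abs_of_nonneg (by positivity)]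
        refine ⟨n, fun k => u n k * (((j.succPNat : ℝ) ^ (-1 / p k) : ℝ) : 𝕜),
          fun k _ => ?_, fun k => ?_, ?_⟩
        · rw [hnorm]; exact hle1 _ _
        · rw [hnorm, ← Real.rpow_mul (by positivity), div_mul_cancel₀ _ (hp k).ne',
            Real.rpow_neg_one, one_div]
          simp
        · have : ∑ k ∈ Finset.Ioc m n, A n k * (u n k * (((j.succPNat : ℝ) ^ (-1 / p k) : ℝ) : 𝕜)) =
              ((∑ k ∈ Finset.Ioc m n, ‖A n k‖ * (j.succPNat : ℝ) ^ (-1 / p k) : ℝ) : 𝕜) := by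
            rw [RCLike.ofReal_sum]
            refine Finset.sum_congr rfl fun k _ => ?_
            rw [RCLike.ofReal_mul, hu]
            ring
          rw [this, RCLike.norm_ofReal]
          exact hn.trans_le (le_abs_self _))
    refine hyB (h y ?_)
    change Tendsto _ _ _
    rw [Metric.tendsto_atTop]
    intro ε hε
    obtain ⟨J, hJ⟩ := exists_nat_one_div_lt hε
    refine ⟨N J + 1, fun k hk => ?_⟩
    obtain ⟨j, hj⟩ := exists_mem_Ioc_of_strictMono hN hN0 (Nat.zero_lt_of_lt hk)
    have hJj : J ≤ j := by
      by_contra hlt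
      have : N (j + 1) ≤ N J := hN.monotone (not_le.1 hlt)
      have := (Finset.mem_Ioc.1 hj).2
      omega
    obtain ⟨v, hv, hyv⟩ := hyP j
    rw [hyv k hj, Real.dist_eq, sub_zero, abs_of_nonneg (by positivity)]
    refine (hv k).trans_lt (lt_of_le_of_lt ?_ hJ)
    exact one_div_le_one_div_of_le (by positivity) (by exact_mod_cast Nat.succ_le_succ hJj)
  · rintro ⟨L, B, hB⟩ y hy
    have hL : (0 : ℝ) < L := by exact_mod_cast L.pos
    have hev : ∀ᶠ k in atTop, ‖y k‖ ^ p k < (L : ℝ)⁻¹ :=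
      (show Tendsto _ _ _ from hy).eventually (gt_mem_nhds (inv_pos.2 hL))
    obtain ⟨K, hK⟩ := eventually_atTop.1 hev
    -- From `K` on, `‖y k‖ ≤ L ^ (-1 / p k)`; the sum in `R` absorbs the finitely many earlier
    -- indices, giving one bound for all `k`.
    set R : ℝ := 1 + ∑ k ∈ Finset.range K, ‖y k‖ * (L : ℝ) ^ (1 / p k) with hR
    have hR0 : ∀ s : Finset ℕ, 0 ≤ ∑ k ∈ s, ‖y k‖ * (L : ℝ) ^ (1 / p k) := fun s =>
      Finset.sum_nonneg fun k _ => by positivity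
    have hyR : ∀ k, ‖y k‖ ≤ R * (L : ℝ) ^ (-1 / p k) := by
      intro k
      have hLk : 0 < (L : ℝ) ^ (-1 / p k) := by positivity
      rcases lt_or_ge k K with hk | hk
      · have h1 : ‖y k‖ * (L : ℝ) ^ (1 / p k) ≤ R := by
          have := Finset.single_le_sum (f := fun k => ‖y k‖ * (L : ℝ) ^ (1 / p k))
            (fun k _ => by positivity) (Finset.mem_range.2 hk)
          rw [hR]
          linarith
        have h2 : (L : ℝ) ^ (1 / p k) * (L : ℝ) ^ (-1 / p k) = 1 := by
          rw [← Real.rpow_add hL, neg_div, add_neg_cancel, Real.rpow_zero]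
        calc ‖y k‖ = ‖y k‖ * (L : ℝ) ^ (1 / p k) * (L : ℝ) ^ (-1 / p k) := by
              rw [mul_assoc, h2, mul_one]
          _ ≤ _ := mul_le_mul_of_nonneg_right h1 hLk.le
      · have h1 : ‖y k‖ ≤ (L : ℝ) ^ (-1 / p k) := by
          have := Real.rpow_le_rpow (by positivity) (hK k hk).le (one_div_pos.2 (hp k)).le
          rwa [← Real.rpow_mul (norm_nonneg _), mul_one_div_cancel (hp k).ne', Real.rpow_one,
            ← Real.rpow_neg_one, ← Real.rpow_mul hL.le, mul_one_div] at this
        refine h1.trans (le_mul_of_one_le_left hLk.le ?_)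
        have := hR0 (Finset.range K)
        linarith
    refine ⟨R * B, ?_⟩
    rintro _ ⟨n, rfl⟩
    have hRp : 0 ≤ R := by have := hR0 (Finset.range K); linarith
    calc ‖∑ k ∈ Finset.range (n + 1), A n k * y k‖
        ≤ ∑ k ∈ Finset.range (n + 1), R * (‖A n k‖ * (L : ℝ) ^ (-1 / p k)) := by
          refine norm_sum_le_of_le _ fun k _ => ?_
          rw [norm_mul, mul_left_comm]
          exact mul_le_mul_of_nonneg_left (hyR k) (norm_nonneg _)
      _ ≤ R * B := by
          rw [← Finset.mul_sum]
          exact mul_le_mul_of_nonneg_left (hB ⟨n, rfl⟩) hRp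

/-- A sequence in `c(p)` with limit `l` is an element of `c_0(p)` plus `l` times the constant 1, and
the constant 1 tests the row sums. -/
theorem mapsToBounded_maddoxC_iff {A : ℕ → ℕ → 𝕜} {p : ℕ → ℝ} (hp : ∀ k, 0 < p k) :
    MapsToBounded A (maddoxC p) ↔ MapsToBounded A (maddoxC0 p) ∧
      BddAbove (Set.range fun n => ‖∑ k ∈ Finset.range (n + 1), A n k‖) := by
  constructor
  · intro h
    refine ⟨h.mono fun y hy => ⟨0, by simpa [maddoxC0] using hy⟩, ?_⟩
    have h1 : (fun _ => 1 : ℕ → 𝕜) ∈ maddoxC p :=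
      ⟨1, by simp [Real.zero_rpow (hp _).ne']⟩
    simpa using h _ h1
  · rintro ⟨h0, B, hB⟩ y ⟨l, hl⟩
    obtain ⟨B', hB'⟩ := h0 (fun k => y k - l) hl
    refine ⟨B' + B * ‖l‖, ?_⟩
    rintro _ ⟨n, rfl⟩
    have : ∑ k ∈ Finset.range (n + 1), A n k * y k =
        ∑ k ∈ Finset.range (n + 1), A n k * (y k - l) +
          (∑ k ∈ Finset.range (n + 1), A n k) * l := by
      rw [Finset.sum_mul, ← Finset.sum_add_distrib]
      exact Finset.sum_congr rfl fun k _ => by ring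
    simp only [this]
    refine (norm_add_le _ _).trans (add_le_add (hB' ⟨n, rfl⟩) ?_)
    rw [norm_mul]
    exact mul_le_mul_of_nonneg_right (hB ⟨n, rfl⟩) (norm_nonneg _)

/-- Membership in `l_∞(p)` means `‖y k‖ ≤ L ^ (1 / p k)` for some `L`, so the space is a union of
weighted sup-norm balls, and each ball gives one row condition. -/
theorem mapsToBounded_maddoxLinf_iff {A : ℕ → ℕ → 𝕜} (hA : ∀ n k, n < k → A n k = 0)
    {p : ℕ → ℝ} (hp : ∀ k, 0 < p k) :
    MapsToBounded A (maddoxLinf p) ↔ ∀ L : ℕ+, BddAbove (Set.range fun n =>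
      ∑ k ∈ Finset.range (n + 1), ‖A n k‖ * (L : ℝ) ^ (1 / p k)) := by
  constructor
  · intro h L
    obtain ⟨C, hC⟩ := h.exists_column_bound hA fun i =>
      (show Tendsto _ _ _ from maddoxC0_single p hp i).bddAbove_range
    by_contra hcon
    have hL : (0 : ℝ) < L := by exact_mod_cast L.pos
    have hnorm : ∀ k, ‖(((L : ℝ) ^ (1 / p k) : ℝ) : 𝕜)‖ = (L : ℝ) ^ (1 / p k) := fun k => by
      rw [RCLike.norm_ofReal, abs_of_nonneg (by positivity)]
    have hC' : ∀ n k, ‖A n k‖ * (L : ℝ) ^ (1 / p k) ≤ C k * (L : ℝ) ^ (1 / p k) := fun n k =>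
      mul_le_mul_of_nonneg_right (hC n k) (by positivity)
    choose u hu1 hu using fun n k => RCLike.exists_norm_eq_mul_self (A n k)
    -- Scaling column `k` by `L ^ (1 / p k)` turns the ball into the unit ball, so unimodular blocks
    -- suffice and no further property `P` is needed.
    obtain ⟨-, y, -, -, hy1, -, -, hyB⟩ := exists_gliding_hump
      (A := fun n k => A n k * (((L : ℝ) ^ (1 / p k) : ℝ) : 𝕜))
      (C := fun k => C k * (L : ℝ) ^ (1 / p k))
      (fun n k => by rw [norm_mul, hnorm]; exact hC' n k) (fun _ _ _ _ => True) (by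
        intro j m M hM
        obtain ⟨n, hn⟩ := exists_lt_sum_Ioc (fun n k => by positivity) hC' hcon m M
        refine ⟨n, u n, fun k _ => (hu1 n k).le, trivial, ?_⟩
        have : ∑ k ∈ Finset.Ioc m n, A n k * (((L : ℝ) ^ (1 / p k) : ℝ) : 𝕜) * u n k =
            ((∑ k ∈ Finset.Ioc m n, ‖A n k‖ * (L : ℝ) ^ (1 / p k) : ℝ) : 𝕜) := by
          rw [RCLike.ofReal_sum]
          refine Finset.sum_congr rfl fun k _ => ?_
          rw [RCLike.ofReal_mul, hu]
          ring
        rw [this, RCLike.norm_ofReal]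
        exact hn.trans_le (le_abs_self _))
    simp only [mul_assoc] at hyB
    refine hyB (h (fun k => (((L : ℝ) ^ (1 / p k) : ℝ) : 𝕜) * y k) ⟨L, ?_⟩)
    rintro _ ⟨k, rfl⟩
    simp only
    rw [norm_mul, hnorm, Real.mul_rpow (by positivity) (norm_nonneg _), ← Real.rpow_mul hL.le,
      one_div_mul_cancel (hp k).ne', Real.rpow_one]
    exact mul_le_of_le_one_right hL.le (Real.rpow_le_one (norm_nonneg _) (hy1 k) (hp k).le)
  · rintro h y ⟨K, hK⟩
    obtain ⟨L, hL⟩ := exists_nat_gt K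
    obtain ⟨B, hB⟩ := h L.succPNat
    refine ⟨B, ?_⟩
    rintro _ ⟨n, rfl⟩
    refine (norm_sum_le_of_le _ fun k _ => ?_).trans (hB ⟨n, rfl⟩)
    rw [norm_mul]
    refine mul_le_mul_of_nonneg_left ?_ (norm_nonneg _)
    have h1 : ‖y k‖ ^ p k ≤ (L.succPNat : ℝ) := by
      have := hK ⟨k, rfl⟩
      simp only at this
      rw [Nat.succPNat_coe, Nat.cast_succ]
      linarith
    have := Real.rpow_le_rpow (by positivity) h1 (one_div_pos.2 (hp k)).le
    rwa [← Real.rpow_mul (norm_nonneg _), mul_one_div_cancel (hp k).ne', Real.rpow_one] at this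

/-! ### Matrices on `l(p)` -/

/-- A sequence glued from blocks of geometrically decreasing modular lies in `l(p)`. -/
theorem mem_maddoxL_of_blocks {p : ℕ → ℝ} (hp : ∀ k, 0 < p k) {N : ℕ → ℕ} (hN : StrictMono N)
    (hN0 : N 0 = 0) {y : ℕ → 𝕜} (hy0 : y 0 = 0)
    (h : ∀ j, ∑ k ∈ Finset.Ioc (N j) (N (j + 1)), ‖y k‖ ^ p k ≤ (1 / 2) ^ j) :
    y ∈ maddoxL p := by
  have hpart : ∀ J, ∑ k ∈ Finset.range (N J + 1), ‖y k‖ ^ p k ≤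
      ∑ j ∈ Finset.range J, (1 / 2 : ℝ) ^ j := by
    intro J
    induction J with
    | zero => simp [hN0, hy0, Real.zero_rpow (hp 0).ne']
    | succ J ih =>
      rw [sum_range_succ_eq_add_sum_Ioc _ (hN (Nat.lt_succ_self J)).le,
        Finset.sum_range_succ _ J]
      exact add_le_add ih (h J)
  refine summable_of_sum_range_le (c := 2) (fun k => by positivity) fun n => ?_
  calc ∑ k ∈ Finset.range n, ‖y k‖ ^ p k ≤ ∑ k ∈ Finset.range (N n + 1), ‖y k‖ ^ p k :=
        Finset.sum_le_sum_of_subset_of_nonneg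
          (Finset.range_mono ((hN.id_le n).trans (Nat.le_succ _))) fun k _ _ => by positivity
    _ ≤ _ := hpart n
    _ ≤ 2 := sum_geometric_two_le n

/-- The gliding hump specialised to `l(p)`: modulars at most `(1 / 2) ^ j` make the glued sequence
summable and already force block entries of norm at most 1. -/
theorem not_mapsToBounded_maddoxL {A : ℕ → ℕ → 𝕜} {C : ℕ → ℝ} (hC : ∀ n k, ‖A n k‖ ≤ C k)
    {p : ℕ → ℝ} (hp : ∀ k, 0 < p k)
    (h : ∀ (j m : ℕ) (M : ℝ), 0 ≤ M → ∃ (n : ℕ) (v : ℕ → 𝕜),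
      ∑ k ∈ Finset.Ioc m n, ‖v k‖ ^ p k ≤ (1 / 2) ^ j ∧
      M < ‖∑ k ∈ Finset.Ioc m n, A n k * v k‖) :
    ¬ MapsToBounded A (maddoxL p) := by
  obtain ⟨N, y, hN, hN0, -, hy0, hyP, hyB⟩ := exists_gliding_hump hC
    (fun j m n v => ∑ k ∈ Finset.Ioc m n, ‖v k‖ ^ p k ≤ (1 / 2) ^ j) (by
      intro j m M hM
      obtain ⟨n, v, hv, hvM⟩ := h j m M hM
      refine ⟨n, v, fun k hk => ?_, hv, hvM⟩
      have h1 : ‖v k‖ ^ p k ≤ 1 :=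
        ((Finset.single_le_sum (f := fun k => ‖v k‖ ^ p k) (fun k _ => by positivity) hk).trans
          hv).trans (pow_le_one₀ (by norm_num) (by norm_num))
      by_contra hlt
      exact h1.not_gt (Real.one_lt_rpow (not_le.1 hlt) (hp k)))
  intro hA
  refine hyB (hA y (mem_maddoxL_of_blocks hp hN hN0 hy0 fun j => ?_))
  obtain ⟨v, hv, hyv⟩ := hyP j
  rwa [Finset.sum_congr rfl fun k hk => by rw [hyv k hk]]

theorem mapsToBounded_maddoxL_iff_of_one_lt {A : ℕ → ℕ → 𝕜} (hA : ∀ n k, n < k → A n k = 0)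
    {p : ℕ → ℝ} (hp : ∀ k, 1 < p k) :
    MapsToBounded A (maddoxL p) ↔ ∃ L : ℕ+, BddAbove (Set.range fun n =>
      ∑ k ∈ Finset.range (n + 1), ‖A n k * (L : 𝕜)⁻¹‖ ^ (p k / (p k - 1))) := by
  have hp0 : ∀ k, 0 < p k := fun k => one_pos.trans (hp k)
  have hq : ∀ k, 0 < p k / (p k - 1) := fun k => div_pos (hp0 k) (sub_pos.2 (hp k))
  have hnL : ∀ (L : ℕ+) (z : 𝕜), ‖z * (L : 𝕜)⁻¹‖ = ‖z‖ / (L : ℝ) := fun L z => by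
    rw [norm_mul, norm_inv, RCLike.norm_natCast, div_eq_mul_inv]
  constructor
  · intro h
    obtain ⟨C, hC⟩ := h.exists_column_bound hA (maddoxL_single p hp0)
    by_contra! hcon
    refine not_mapsToBounded_maddoxL hC hp0 ?_ h
    intro j m M hM
    -- The block built below has transform exactly `L / 2 ^ j`, which has to exceed `M`.
    obtain ⟨L₀, hL₀⟩ := exists_nat_gt (2 ^ j * M)
    set L : ℕ+ := L₀.succPNat
    have hL1 : (1 : ℝ) ≤ L := by exact_mod_cast L.pos
    have hL0 : (0 : ℝ) < L := by linarith
    have hLM : 2 ^ j * M < L := hL₀.trans (by simp [L])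
    -- A tail `S > 1` ensures `2 ^ j * S ≥ 1`, so raising `(2 ^ j * S)⁻¹` to a power `p k > 1` only
    -- decreases it.
    obtain ⟨n, hn⟩ := exists_lt_sum_Ioc (C := fun k => C k ^ (p k / (p k - 1)))
      (fun n k => by positivity)
      (fun n k => Real.rpow_le_rpow (norm_nonneg _) (by
        rw [hnL]; exact (div_le_self (norm_nonneg _) hL1).trans (hC n k)) (hq k).le)
      (hcon L) m 1
    set S := ∑ k ∈ Finset.Ioc m n, ‖A n k * (L : 𝕜)⁻¹‖ ^ (p k / (p k - 1)) with hS
    have hS0 : 0 < S := one_pos.trans hn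
    choose u hu1 hu using fun k => RCLike.exists_norm_eq_mul_self (A n k)
    -- The equality case of Hölder: with `q = p k / (p k - 1)` one has `(q - 1) * p k = q`, so
    -- modular and transform are both governed by `S`; the factor `(2 ^ j * S)⁻¹` normalises the
    -- modular to at most `(1 / 2) ^ j`.
    set w : ℕ → ℝ := fun k =>
      ‖A n k * (L : 𝕜)⁻¹‖ ^ (p k / (p k - 1) - 1) * (2 ^ j * S)⁻¹ with hw
    have hw0 : ∀ k, 0 ≤ w k := fun k => by positivity
    have hnorm : ∀ k, ‖u k * (w k : 𝕜)‖ = w k := fun k => by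
      rw [norm_mul, hu1, one_mul, RCLike.norm_ofReal, abs_of_nonneg (hw0 k)]
    have h2S : 1 ≤ 2 ^ j * S := one_le_mul_of_one_le_of_one_le
      (one_le_pow₀ (by norm_num)) hn.le
    refine ⟨n, fun k => u k * (w k : 𝕜), ?_, ?_⟩
    · calc ∑ k ∈ Finset.Ioc m n, ‖u k * (w k : 𝕜)‖ ^ p k
          ≤ ∑ k ∈ Finset.Ioc m n,
              ‖A n k * (L : 𝕜)⁻¹‖ ^ (p k / (p k - 1)) * (2 ^ j * S)⁻¹ := by
            refine Finset.sum_le_sum fun k _ => ?_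
            rw [hnorm, hw, Real.mul_rpow (by positivity) (by positivity),
              ← Real.rpow_mul (norm_nonneg _)]
            have he : (p k / (p k - 1) - 1) * p k = p k / (p k - 1) := by
              have : p k - 1 ≠ 0 := (sub_pos.2 (hp k)).ne'
              field_simp
              ring
            rw [he]
            refine mul_le_mul_of_nonneg_left ?_ (by positivity)
            calc ((2 ^ j * S)⁻¹) ^ p k ≤ ((2 ^ j * S)⁻¹) ^ (1 : ℝ) :=
                  Real.rpow_le_rpow_of_exponent_ge (by positivity) (inv_le_one_of_one_le₀ h2S)
                    (hp k).le
              _ = _ := Real.rpow_one _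
        _ = (1 / 2) ^ j := by
            rw [← Finset.sum_mul, ← hS, one_div, inv_pow]
            field_simp
    · have hsum : ∑ k ∈ Finset.Ioc m n, A n k * (u k * (w k : 𝕜)) =
          ((L * (S * (2 ^ j * S)⁻¹) : ℝ) : 𝕜) := by
        have : (L : ℝ) * (S * (2 ^ j * S)⁻¹) = ∑ k ∈ Finset.Ioc m n, ‖A n k‖ * w k := by
          rw [hS, Finset.sum_mul, ← hS, Finset.mul_sum]
          refine Finset.sum_congr rfl fun k _ => ?_
          have hz : ‖A n k * (L : 𝕜)⁻¹‖ ^ (p k / (p k - 1)) =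
              ‖A n k * (L : 𝕜)⁻¹‖ * ‖A n k * (L : 𝕜)⁻¹‖ ^ (p k / (p k - 1) - 1) := by
            rw [← Real.rpow_one_add' (norm_nonneg _) (by rw [add_sub_cancel]; exact (hq k).ne'),
              add_sub_cancel]
          rw [hz, hw]
          simp only [hnL]
          field_simp
        rw [this, RCLike.ofReal_sum]
        refine Finset.sum_congr rfl fun k _ => ?_
        rw [RCLike.ofReal_mul ‖A n k‖ (w k), hu]
        ring
      rw [hsum, RCLike.norm_ofReal]
      refine lt_of_lt_of_le ?_ (le_abs_self _)
      have : (L : ℝ) * (S * (2 ^ j * S)⁻¹) = L / 2 ^ j := by field_simp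
      rw [this, lt_div_iff₀ (by positivity), mul_comm]
      exact hLM
  · rintro ⟨L, B, hB⟩ y hy
    have hL0 : (0 : ℝ) < L := by exact_mod_cast L.pos
    have hy' : Summable fun k => ‖y k‖ ^ p k := hy
    -- Young's inequality termwise, with the factors `1 / p k` and `1 / q` bounded by 1.
    refine ⟨L * (B + ∑' k, ‖y k‖ ^ p k), ?_⟩
    rintro _ ⟨n, rfl⟩
    calc ‖∑ k ∈ Finset.range (n + 1), A n k * y k‖
        ≤ ∑ k ∈ Finset.range (n + 1),
          L * (‖A n k * (L : 𝕜)⁻¹‖ ^ (p k / (p k - 1)) + ‖y k‖ ^ p k) := by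
          refine norm_sum_le_of_le _ fun k _ => ?_
          have hconj : (p k).HolderConjugate (p k / (p k - 1)) :=
            Real.HolderConjugate.conjExponent (hp k)
          have hy := Real.young_inequality_of_nonneg (norm_nonneg (A n k * (L : 𝕜)⁻¹))
            (norm_nonneg (y k)) hconj.symm
          have h1 : ‖A n k * (L : 𝕜)⁻¹‖ ^ (p k / (p k - 1)) / (p k / (p k - 1)) ≤
              ‖A n k * (L : 𝕜)⁻¹‖ ^ (p k / (p k - 1)) :=
            div_le_self (by positivity) hconj.symm.lt.le
          have h2 : ‖y k‖ ^ p k / p k ≤ ‖y k‖ ^ p k := div_le_self (by positivity) (hp k).le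
          have h3 : ‖A n k * y k‖ = L * (‖A n k * (L : 𝕜)⁻¹‖ * ‖y k‖) := by
            rw [norm_mul, hnL]
            field_simp
          rw [h3]
          exact mul_le_mul_of_nonneg_left (hy.trans (add_le_add h1 h2)) hL0.le
      _ ≤ _ := by
          rw [← Finset.mul_sum, Finset.sum_add_distrib]
          refine mul_le_mul_of_nonneg_left (add_le_add (hB ⟨n, rfl⟩) ?_) hL0.le
          exact hy'.sum_le_tsum _ fun k _ => by positivity

theorem mapsToBounded_maddoxL_iff_of_le_one {A : ℕ → ℕ → 𝕜} (hA : ∀ n k, n < k → A n k = 0)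
    {p : ℕ → ℝ} (hp : ∀ k, 0 < p k) (hp1 : ∀ k, p k ≤ 1) :
    MapsToBounded A (maddoxL p) ↔ ∃ (L : ℕ+) (B : ℝ), ∀ n k,
      ‖A n k * (L : 𝕜)⁻¹‖ ^ p k ≤ B := by
  constructor
  · intro h
    obtain ⟨C, hC⟩ := h.exists_column_bound hA (maddoxL_single p hp)
    have hC0 : ∀ k, 0 ≤ C k := fun k => (norm_nonneg _).trans (hC 0 k)
    by_contra! hcon
    refine not_mapsToBounded_maddoxL hC hp ?_ h
    intro j m M hM
    obtain ⟨n, k, hnk⟩ := hcon 1 (∑ k ∈ Finset.range (m + 1), C k ^ p k + 2 ^ j * (M + 1))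
    simp only [PNat.one_coe, Nat.cast_one, inv_one, mul_one] at hnk
    have hsum0 : ∀ s : Finset ℕ, 0 ≤ ∑ k ∈ s, C k ^ p k := fun s =>
      Finset.sum_nonneg fun k _ => Real.rpow_nonneg (hC0 k) _
    have h2M : 0 < (2 : ℝ) ^ j * (M + 1) := by positivity
    have hmk : m < k := by
      by_contra hle
      have h1 := Finset.single_le_sum (f := fun k => C k ^ p k)
        (fun k _ => Real.rpow_nonneg (hC0 k) _)
        (Finset.mem_range.2 (Nat.lt_succ_of_le (not_lt.1 hle)))
      have h2 := Real.rpow_le_rpow (norm_nonneg _) (hC n k) (hp k).le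
      have h3 := h1.trans' h2
      linarith
    have hkn : k ≤ n := by
      by_contra hlt
      rw [hA n k (not_le.1 hlt), norm_zero, Real.zero_rpow (hp k).ne'] at hnk
      have := hsum0 (Finset.range (m + 1))
      linarith
    have hmem : k ∈ Finset.Ioc m n := Finset.mem_Ioc.2 ⟨hmk, hkn⟩
    set c : ℝ := ((1 / 2 : ℝ) ^ j) ^ (1 / p k) with hc
    have hc0 : 0 ≤ c := by positivity
    have hcp : c ^ p k = (1 / 2) ^ j := by
      rw [hc, ← Real.rpow_mul (by positivity), one_div_mul_cancel (hp k).ne', Real.rpow_one]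
    refine ⟨n, Pi.single k (c : 𝕜), ?_, ?_⟩
    · rw [Finset.sum_eq_single_of_mem k hmem]
      · rw [Pi.single_eq_same, RCLike.norm_ofReal, abs_of_nonneg hc0, hcp]
      · intro i _ hi
        rw [Pi.single_eq_of_ne hi, norm_zero, Real.zero_rpow (hp i).ne']
    · rw [Finset.sum_eq_single_of_mem k hmem]
      · rw [Pi.single_eq_same, norm_mul, RCLike.norm_ofReal, abs_of_nonneg hc0]
        have h1 : M + 1 ≤ (‖A n k‖ * c) ^ p k := by
          rw [Real.mul_rpow (norm_nonneg _) hc0, hcp, one_div, inv_pow, ← div_eq_mul_inv,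
            le_div_iff₀ (by positivity), mul_comm]
          have := hsum0 (Finset.range (m + 1))
          linarith
        have h2 : 1 ≤ ‖A n k‖ * c := by
          by_contra hlt
          have := Real.rpow_lt_one (by positivity) (not_le.1 hlt) (hp k)
          linarith
        have h3 := Real.rpow_le_rpow_of_exponent_le h2 (hp1 k)
        rw [Real.rpow_one] at h3
        linarith
      · intro i _ hi
        rw [Pi.single_eq_of_ne hi, mul_zero]
  · rintro ⟨L, B, hB⟩ y hy
    have hL1 : (1 : ℝ) ≤ L := by exact_mod_cast L.pos
    have hB0 : 0 ≤ B := le_trans (by positivity) (hB 0 0)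
    have hAB : ∀ n k, ‖A n k‖ ^ p k ≤ B * L := by
      intro n k
      have h1 := hB n k
      rw [norm_mul, Real.mul_rpow (norm_nonneg _) (norm_nonneg _), norm_inv,
        RCLike.norm_natCast, Real.inv_rpow (by positivity), ← div_eq_mul_inv,
        div_le_iff₀ (by positivity)] at h1
      refine h1.trans (mul_le_mul_of_nonneg_left ?_ hB0)
      simpa using Real.rpow_le_rpow_of_exponent_le hL1 (hp1 k)
    set G : ℕ → ℝ := fun k => B * L * ‖y k‖ ^ p k with hG
    have hG0 : ∀ k, 0 ≤ G k := fun k => by positivity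
    have hGs : Summable G := Summable.mul_left _ hy
    have hHs : Summable fun k => G k ^ (1 / p k) := by
      refine Summable.of_norm_bounded_eventually_nat hGs ?_
      filter_upwards [hGs.tendsto_atTop_zero.eventually (gt_mem_nhds one_pos)] with k hk
      rw [Real.norm_of_nonneg (Real.rpow_nonneg (hG0 k) _)]
      rcases (hG0 k).eq_or_lt with h0 | h0
      · rw [← h0, Real.zero_rpow (one_div_pos.2 (hp k)).ne']
      · simpa using Real.rpow_le_rpow_of_exponent_ge h0 hk.le ((one_le_div (hp k)).2 (hp1 k))
    refine ⟨∑' k, G k ^ (1 / p k), ?_⟩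
    rintro _ ⟨n, rfl⟩
    refine (norm_sum_le_of_le _ fun k _ => ?_).trans
      (hHs.sum_le_tsum (Finset.range (n + 1)) fun k _ => Real.rpow_nonneg (hG0 k) _)
    have h1 : ‖A n k * y k‖ ^ p k ≤ G k := by
      rw [norm_mul, Real.mul_rpow (norm_nonneg _) (norm_nonneg _)]
      exact mul_le_mul_of_nonneg_right (hAB n k) (by positivity)
    have := Real.rpow_le_rpow (by positivity) h1 (one_div_pos.2 (hp k)).le
    rwa [← Real.rpow_mul (norm_nonneg _), mul_one_div_cancel (hp k).ne', Real.rpow_one] at this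

/-! ### Row conditions in `[0, ∞]` and in `ℝ` -/

theorem iSup_ofReal_lt_top_iff {ι : Type*} {f : ι → ℝ} (hf : ∀ i, 0 ≤ f i) :
    (⨆ i, ENNReal.ofReal (f i)) < ⊤ ↔ BddAbove (Set.range f) := by
  constructor
  · intro h
    refine ⟨(⨆ i, ENNReal.ofReal (f i)).toReal, ?_⟩
    rintro _ ⟨i, rfl⟩
    rw [← ENNReal.toReal_ofReal (hf i)]
    exact ENNReal.toReal_mono h.ne (le_iSup (fun i => ENNReal.ofReal (f i)) i)
  · rintro ⟨B, hB⟩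
    exact (iSup_le fun i => ENNReal.ofReal_le_ofReal (hB ⟨i, rfl⟩)).trans_lt ENNReal.ofReal_lt_top

theorem iSup_tsum_ofReal_lt_top_iff {f : ℕ → ℕ → ℝ} (hf : ∀ n k, 0 ≤ f n k)
    (h0 : ∀ n k, n < k → f n k = 0) :
    (⨆ n, ∑' k, ENNReal.ofReal (f n k)) < ⊤ ↔
      BddAbove (Set.range fun n => ∑ k ∈ Finset.range (n + 1), f n k) := by
  rw [← iSup_ofReal_lt_top_iff fun n => Finset.sum_nonneg fun k _ => hf n k]
  have : ∀ n, ∑' k, ENNReal.ofReal (f n k) =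
      ENNReal.ofReal (∑ k ∈ Finset.range (n + 1), f n k) := by
    intro n
    rw [ENNReal.ofReal_sum_of_nonneg fun k _ => hf n k]
    refine tsum_eq_sum fun k hk => ?_
    rw [h0 n k (by simpa using hk), ENNReal.ofReal_zero]
  simp only [this]

end GenMeans

theorem theorem4p4 {𝕜 : Type*} [RCLike 𝕜] (r s t : ℕ → 𝕜) (p : ℕ → ℝ)
    (hr : ∀ n, r n ≠ 0) (ht : ∀ n, t n ≠ 0) (hs : s 0 ≠ 0)
    (hp : ∀ k, 0 < p k) (hpb : BddAbove (Set.range p)) :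
    ((∀ k, 1 < p k) →
      GenMeans.gammaDual (GenMeans.meanDiffSpace (GenMeans.maddoxL p) r s t) =
        GenMeans.Gamma5 r s t p) ∧
    ((∀ k, p k ≤ 1) →
      GenMeans.gammaDual (GenMeans.meanDiffSpace (GenMeans.maddoxL p) r s t) =
        GenMeans.Gamma4 r s t p) ∧
    GenMeans.gammaDual (GenMeans.meanDiffSpace (GenMeans.maddoxC0 p) r s t) =
      GenMeans.Gamma1 r s t p ∧
    GenMeans.gammaDual (GenMeans.meanDiffSpace (GenMeans.maddoxC p) r s t) =
      GenMeans.Gamma1 r s t p ∩ GenMeans.Gamma2 r s t ∧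
    GenMeans.gammaDual (GenMeans.meanDiffSpace (GenMeans.maddoxLinf p) r s t) =
      GenMeans.Gamma3 r s t p := by
  have hE : ∀ a n k, n < k → GenMeans.E r s t a n k = 0 := fun a n k h =>
    GenMeans.E_eq_zero r s t a h
  have h1 : ∀ a, GenMeans.MapsToBounded (GenMeans.E r s t a) (GenMeans.maddoxC0 p) ↔
      a ∈ GenMeans.Gamma1 r s t p := by
    intro a
    rw [GenMeans.mapsToBounded_maddoxC0_iff (hE a) hp]
    simp only [GenMeans.Gamma1, Set.mem_iUnion, Set.mem_ofPred_eq]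
    refine exists_congr fun L => ?_
    rw [GenMeans.iSup_tsum_ofReal_lt_top_iff (fun n k => by positivity)
      (fun n k h => by rw [hE a n k h, norm_zero, zero_mul])]
  refine ⟨fun hp1 => ?_, fun hp1 => ?_, ?_, ?_, ?_⟩ <;> ext a <;>
    rw [GenMeans.mem_gammaDual_iff _ r s t a hr ht hs]
  · rw [GenMeans.mapsToBounded_maddoxL_iff_of_one_lt (hE a) hp1]
    simp only [GenMeans.Gamma5, Set.mem_iUnion, Set.mem_ofPred_eq]
    refine exists_congr fun L => ?_
    rw [GenMeans.iSup_tsum_ofReal_lt_top_iff (fun n k => by positivity)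
      (fun n k h => by
        rw [hE a n k h, zero_mul, norm_zero,
          Real.zero_rpow (div_pos (hp k) (sub_pos.2 (hp1 k))).ne'])]
  · rw [GenMeans.mapsToBounded_maddoxL_iff_of_le_one (hE a) hp hp1]
    simp only [GenMeans.Gamma4, Set.mem_iUnion, Set.mem_ofPred_eq]
    refine exists_congr fun L => ?_
    rw [← iSup_prod (f := fun x : ℕ × ℕ =>
        ENNReal.ofReal (‖GenMeans.E r s t a x.1 x.2 * (L : 𝕜)⁻¹‖ ^ p x.2)),
      GenMeans.iSup_ofReal_lt_top_iff fun x => by positivity]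
    exact ⟨fun ⟨B, hB⟩ => ⟨B, by rintro _ ⟨x, rfl⟩; exact hB x.1 x.2⟩,
      fun ⟨B, hB⟩ => ⟨B, fun n k => hB ⟨(n, k), rfl⟩⟩⟩
  · exact h1 a
  · rw [GenMeans.mapsToBounded_maddoxC_iff hp, h1 a]
    refine and_congr Iff.rfl ?_
    have : ∀ n, ∑' k, GenMeans.E r s t a n k =
        ∑ k ∈ Finset.range (n + 1), GenMeans.E r s t a n k := fun n =>
      tsum_eq_sum fun k hk => hE a n k (by simpa using hk)
    simp only [GenMeans.Gamma2, Set.mem_ofPred_eq, this]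
  · rw [GenMeans.mapsToBounded_maddoxLinf_iff (hE a) hp]
    simp only [GenMeans.Gamma3, Set.mem_iInter, Set.mem_ofPred_eq]
    refine forall_congr' fun L => ?_
    rw [GenMeans.iSup_tsum_ofReal_lt_top_iff (fun n k => by positivity)
      (fun n k h => by rw [hE a n k h, norm_zero, zero_mul])]
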